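/- Let $p(y\mid x,\theta)$ be a parametric model: for each design point $x$ and each $\theta$ in an open set $\Theta\subseteq\mathbb{R}^k$, $p(\cdot\mid x,\theta)$ is a probability density with respect to a fixed dominating measure. Let $x_1,\dots,x_N$ be design points and $\theta\in\Theta$, and suppose that for each $i$ the information matrix $$M_{x_i}=-\mathbb{E}\left[\frac{\partial^2\log p(y\mid x_i,\theta)}{\partial\theta^2}\right]\in\mathbb{R}^{k\times k},\qquad y\sim p(\cdot\mid x_i,\theta),$$ is well defined (for almost every $y$ the density is differentiable in the parameter near $\theta$ and twice differentiable at $\theta$, and the entries of the Hessian of $\log p$ have finite expectation). Let $1\le q\le k$ and let $g$ be an $\mathbb{R}^q$-valued function of the parameter that is differentiable at $\theta$. For $w\in\mathbb{R}^N$ put $M(w)=\sum_{i=1}^N w_iM_{x_i}$ and, when $M(w)$ is invertible, $$\Sigma_g(w)=\frac{\partial g(\theta)}{\partial\theta^T}\,M(w)^{-1}\left(\frac{\partial g(\theta)}{\partial\theta^T}\right)^T .$$ For a positive semidefinite $q\times q$ matrix $A$ let $\Phi_p(A)=\left(q^{-1}\operatorname{Tr}[A^p]\right)^{1/p}$ for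 $0<p<\infty$, and let $\Phi_0(A)=\lim_{p\to0^+}\Phi_p(A)=|A|^{1/q}$, where $|A|$ is the determinant. For $0<\epsilon<1$ let $$\Omega_\epsilon=\Big\{w\in\mathbb{R}^N:\ 0\le w_i\le\epsilon\ (1\le i\le N),\ \sum_{i=1}^N w_i=1\Big\},\qquad \Omega_\epsilon^+=\{w\in\Omega_\epsilon:\ M(w)\text{ is positive definite}\}.$$ Then for every $0\le p<\infty$ the set $\Omega_\epsilon^+$ is convex and the map $w\mapsto\Phi_p(\Sigma_g(w))$ is convex on $\Omega_\epsilon^+$. -/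

import Mathlib

open MeasureTheory Filter Topology

noncomputable section

namespace OptimalSample

/-- A dominated parametric model `p(y | x, θ)`: for every design point `x` and every parameter
`θ` in an open set `Θ ⊆ ℝᵏ`, `density x θ` is a probability density with respect to `base`. -/
structure ParametricModel (X Y : Type*) [MeasurableSpace Y] (k : ℕ) where
  /-- the dominating measure on the space of responses -/
  base : Measure Y
  /-- the parameter set `Θ` -/
  params : Set (EuclideanSpace ℝ (Fin k))
  isOpen_params : IsOpen params
  /-- `density x θ y` is `p(y | x, θ)` -/
  density : X → EuclideanSpace ℝ (Fin k) → Y → ℝ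
  measurable_density : ∀ x, ∀ θ ∈ params, Measurable (density x θ)
  density_nonneg : ∀ x, ∀ θ ∈ params, ∀ y, 0 ≤ density x θ y
  lintegral_density : ∀ x, ∀ θ ∈ params, ∫⁻ y, ENNReal.ofReal (density x θ y) ∂base = 1

namespace ParametricModel

variable {X Y : Type*} [MeasurableSpace Y] {k : ℕ}

/-- The law of the response at the design point `x` under the parameter `θ`. -/
def law (P : ParametricModel X Y k) (x : X) (θ : EuclideanSpace ℝ (Fin k)) : Measure Y :=
  P.base.withDensity fun y => ENNReal.ofReal (P.density x θ y)

/-- The Hessian matrix `∂² log p(y | x, θ) / ∂θ²`. -/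
def logHessian (P : ParametricModel X Y k) (x : X) (θ : EuclideanSpace ℝ (Fin k)) (y : Y) :
    Matrix (Fin k) (Fin k) ℝ :=
  Matrix.of fun i j => iteratedFDeriv ℝ 2 (fun t => Real.log (P.density x t y)) θ
    ![EuclideanSpace.single i 1, EuclideanSpace.single j 1]

/-- The information matrix `M_x = -𝔼 [∂² log p(y | x, θ) / ∂θ²]` of a single design point. -/
def infoMatrix (P : ParametricModel X Y k) (x : X) (θ : EuclideanSpace ℝ (Fin k)) :
    Matrix (Fin k) (Fin k) ℝ :=
  Matrix.of fun i j => -∫ y, P.logHessian x θ y i j ∂P.law x θ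

/-- The information matrix at `x` is well defined at `θ`: for almost every response `y` the density
is twice differentiable in the parameter at `θ` (the density is positive at `θ` for almost every
`y` under the law of the response, so the same holds for its logarithm), and the entries of the
Hessian of the log-density have an expectation. -/
structure HasInfoAt (P : ParametricModel X Y k) (x : X) (θ : EuclideanSpace ℝ (Fin k)) :
    Prop where
  twice_differentiable : ∀ᵐ y ∂P.law x θ,
    (∀ᶠ t in 𝓝 θ, DifferentiableAt ℝ (fun s => P.density x s y) t) ∧
      DifferentiableAt ℝ (fderiv ℝ fun s => P.density x s y) θ
  integrable : ∀ i j, Integrable (fun y => P.logHessian x θ y i j) (P.law x θ)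

end ParametricModel

/-- The Jacobian matrix `∂g(θ) / ∂θᵀ`, of size `q × k`. -/
def jacobian {k q : ℕ} (g : EuclideanSpace ℝ (Fin k) → EuclideanSpace ℝ (Fin q))
    (θ : EuclideanSpace ℝ (Fin k)) : Matrix (Fin q) (Fin k) ℝ :=
  Matrix.of fun a i => fderiv ℝ g θ (EuclideanSpace.single i 1) a

/-- `M(w) = ∑ᵢ wᵢ M_{xᵢ}`. -/
def weightedInfo {X Y : Type*} [MeasurableSpace Y] {k N : ℕ} (P : ParametricModel X Y k)
    (x : Fin N → X) (θ : EuclideanSpace ℝ (Fin k)) (w : Fin N → ℝ) :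
    Matrix (Fin k) (Fin k) ℝ :=
  ∑ i, w i • P.infoMatrix (x i) θ

/-- `Σ_g(w) = (∂g/∂θᵀ) M(w)⁻¹ (∂g/∂θᵀ)ᵀ`. -/
def sigmaG {X Y : Type*} [MeasurableSpace Y] {k q N : ℕ} (P : ParametricModel X Y k)
    (x : Fin N → X) (g : EuclideanSpace ℝ (Fin k) → EuclideanSpace ℝ (Fin q))
    (θ : EuclideanSpace ℝ (Fin k)) (w : Fin N → ℝ) : Matrix (Fin q) (Fin q) ℝ :=
  jacobian g θ * (weightedInfo P x θ w)⁻¹ * (jacobian g θ).transpose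

/-- Kiefer's criterion `Φ_p(A) = (q⁻¹ Tr[A^p])^{1/p}` for a positive semidefinite `q × q` matrix
`A` and `0 < p`, where `A^p` is given by the functional calculus of symmetric matrices (apply
`t ↦ t^p` to the eigenvalues); at `p = 0` it is the limit `|A|^{1/q}` for `p → 0`. -/
def kieferPhi {q : ℕ} (p : ℝ) (A : Matrix (Fin q) (Fin q) ℝ) : ℝ :=
  if p = 0 then A.det ^ (1 / (q : ℝ))
  else ((q : ℝ)⁻¹ * (cfc (fun t : ℝ => t ^ p) A).trace) ^ (1 / p)

/-- `Ω`, the measures (weight vectors) on `N` points. -/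
def Omega (N : ℕ) : Set (Fin N → ℝ) := {w | (∀ i, 0 ≤ w i) ∧ ∑ i, w i = 1}

/-- `Ω_ε`, the measures whose weights are at most `ε`. -/
def OmegaEps (N : ℕ) (ε : ℝ) : Set (Fin N → ℝ) := {w ∈ Omega N | ∀ i, 0 ≤ w i ∧ w i ≤ ε}

/-- `Ω_ε⁺`, the measures in `Ω_ε` with a positive definite information matrix. -/
def OmegaEpsPos {X Y : Type*} [MeasurableSpace Y] {k N : ℕ} (P : ParametricModel X Y k)
    (x : Fin N → X) (θ : EuclideanSpace ℝ (Fin k)) (ε : ℝ) : Set (Fin N → ℝ) :=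
  {w ∈ OmegaEps N ε | (weightedInfo P x θ w).PosDef}

end OptimalSample

end

open Matrix Set

namespace OptimalSample

/-! Write `Σ_g = J M⁻¹ Jᵀ` with `M` linear in `w`. For `p > 1` the outer root is concave, so
convexity of the trace alone does not suffice. But `Φ_p(J M⁻¹ Jᵀ)` is nonnegative and homogeneous of
degree `-1` in `M`, so convexity of its unit sublevel set is enough
(`convexOn_posDef_of_homogeneous`). That set is a sublevel set of `tr f(J M⁻¹ Jᵀ)` with `f = t ^ p`,
or `f = log` when `p = 0` and the matrix is nonsingular.

The trace is convex (`trace_cfc_conj_inv_le`) because a nonzero eigenvalue of `J M⁻¹ Jᵀ` with unit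
eigenvector `u` is the inverse of the minimum of `yᵀ M y` over `J y = u`. The minimizer for the
mixture is a competitor for `M₁` and `M₂`, and Jensen's inequality in their eigenbases does the
rest. `J` may be rank deficient. -/

section Spectral

variable {m n : Type*} [Fintype m] [Fintype n] [DecidableEq m] [DecidableEq n]

/-- The eigenvector basis of a real symmetric matrix, as vectors in `n → ℝ`. -/
noncomputable def eigenvec {A : Matrix n n ℝ} (hA : A.IsHermitian) (i : n) : n → ℝ :=
  WithLp.ofLp (hA.eigenvectorBasis i)

lemma mulVec_eigenvec {A : Matrix n n ℝ} (hA : A.IsHermitian) (i : n) :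
    A *ᵥ eigenvec hA i = hA.eigenvalues i • eigenvec hA i :=
  hA.mulVec_eigenvectorBasis i

lemma eigenvec_dotProduct {A : Matrix n n ℝ} (hA : A.IsHermitian) (i j : n) :
    eigenvec hA i ⬝ᵥ eigenvec hA j = if i = j then 1 else 0 := by
  rw [← orthonormal_iff_ite.mp hA.eigenvectorBasis.orthonormal i j,
    EuclideanSpace.inner_eq_star_dotProduct, star_trivial, dotProduct_comm]
  rfl

lemma sum_sq_eigenvec_dotProduct {A : Matrix n n ℝ} (hA : A.IsHermitian) (v : n → ℝ) :
    ∑ i, (eigenvec hA i ⬝ᵥ v) ^ 2 = v ⬝ᵥ v := by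
  have h := hA.eigenvectorBasis.sum_sq_norm_inner_right (WithLp.toLp 2 v)
  rw [EuclideanSpace.real_norm_sq_eq] at h
  simp only [EuclideanSpace.inner_eq_star_dotProduct, star_trivial, Real.norm_eq_abs,
    sq_abs] at h
  simp only [dotProduct_comm _ v]
  simpa [dotProduct, eigenvec, sq] using h

lemma trace_cfc_eq_sum {A : Matrix n n ℝ} (hA : A.IsHermitian) (f : ℝ → ℝ) :
    (cfc f A).trace = ∑ i, f (hA.eigenvalues i) := by
  rw [hA.cfc_eq, IsHermitian.cfc, Unitary.conjStarAlgAut_apply, trace_mul_cycle]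
  simp [trace_diagonal]

omit [DecidableEq m] in
lemma posSemidef_conj_inv {M : Matrix n n ℝ} (hM : M.PosDef) (J : Matrix m n ℝ) :
    (J * M⁻¹ * Jᵀ).PosSemidef := by
  simpa using hM.inv.posSemidef.mul_mul_conjTranspose_same J

omit [DecidableEq n] in
lemma dotProduct_mulVec_symm {M : Matrix n n ℝ} (hM : M.IsHermitian) (x y : n → ℝ) :
    x ⬝ᵥ M *ᵥ y = y ⬝ᵥ M *ᵥ x := by
  have hT : Mᵀ = M := by rwa [IsHermitian, conjTranspose_eq_transpose_of_trivial] at hM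
  rw [dotProduct_mulVec, ← mulVec_transpose, hT, dotProduct_comm]

lemma mulVec_inv_mulVec {M : Matrix n n ℝ} (hM : M.PosDef) (v : n → ℝ) :
    M *ᵥ (M⁻¹ *ᵥ v) = v := by
  rw [mulVec_mulVec, mul_nonsing_inv _ ((isUnit_iff_isUnit_det _).mp hM.isUnit), one_mulVec]

-- Shows that the kernel of `J M⁻¹ Jᵀ` is that of `Jᵀ`, whatever `M` is; all degenerate cases rest
-- on this.
omit [DecidableEq m] in
lemma transpose_mulVec_eq_zero {M : Matrix n n ℝ} (hM : M.PosDef) {J : Matrix m n ℝ}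
    {v : m → ℝ} (hv : (J * M⁻¹ * Jᵀ) *ᵥ v = 0) : Jᵀ *ᵥ v = 0 := by
  by_contra h
  have h1 := hM.inv.dotProduct_mulVec_pos h
  have h2 : (Jᵀ *ᵥ v) ⬝ᵥ M⁻¹ *ᵥ (Jᵀ *ᵥ v) = v ⬝ᵥ (J * M⁻¹ * Jᵀ) *ᵥ v := by
    rw [mulVec_transpose, ← dotProduct_mulVec]
    simp only [mulVec_mulVec, ← mulVec_transpose, Matrix.mul_assoc]
  rw [star_trivial, h2, hv] at h1
  simp at h1

lemma sum_sq_div_le {M : Matrix n n ℝ} (hM : M.PosDef) (J : Matrix m n ℝ)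
    (hA : (J * M⁻¹ * Jᵀ).IsHermitian) (y : n → ℝ) :
    ∑ j, (eigenvec hA j ⬝ᵥ J *ᵥ y) ^ 2 * (hA.eigenvalues j)⁻¹ ≤ y ⬝ᵥ M *ᵥ y := by
  -- With `0⁻¹ = 0`, `v` is the pseudoinverse of `J M⁻¹ Jᵀ` applied to `J y`. Then `y ⬝ᵥ M *ᵥ x = x
  -- ⬝ᵥ M *ᵥ x = S`, and positivity of the form at `y - x` gives the bound.
  set c : m → ℝ := fun j => (eigenvec hA j ⬝ᵥ J *ᵥ y) * (hA.eigenvalues j)⁻¹ with hc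
  set v : m → ℝ := ∑ j, c j • eigenvec hA j with hv
  set x : n → ℝ := M⁻¹ *ᵥ (Jᵀ *ᵥ v) with hx
  set S := ∑ j, (eigenvec hA j ⬝ᵥ J *ᵥ y) ^ 2 * (hA.eigenvalues j)⁻¹ with hS
  have hMx : M *ᵥ x = Jᵀ *ᵥ v := mulVec_inv_mulVec hM _
  have hxy : y ⬝ᵥ M *ᵥ x = S := by
    rw [hMx, mulVec_transpose, dotProduct_comm, ← dotProduct_mulVec, hv, sum_dotProduct]
    refine Finset.sum_congr rfl fun j _ => ?_
    rw [smul_dotProduct, smul_eq_mul, hc]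
    ring
  have hxx : x ⬝ᵥ M *ᵥ x = S := by
    have h1 : x ⬝ᵥ M *ᵥ x = v ⬝ᵥ (J * M⁻¹ * Jᵀ) *ᵥ v := by
      rw [hMx, mulVec_transpose, dotProduct_comm, ← dotProduct_mulVec, hx]
      simp only [mulVec_mulVec, Matrix.mul_assoc]
    rw [h1, hv, mulVec_sum, sum_dotProduct]
    refine Finset.sum_congr rfl fun j _ => ?_
    simp only [dotProduct_sum, mulVec_smul, mulVec_eigenvec, smul_dotProduct, dotProduct_smul,
      eigenvec_dotProduct, smul_eq_mul, mul_ite, mul_one, mul_zero, Finset.sum_ite_eq,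
      Finset.mem_univ, if_true, hc]
    rcases eq_or_ne (hA.eigenvalues j) 0 with h0 | h0
    · simp [h0]
    · field_simp
  have h := hM.posSemidef.dotProduct_mulVec_nonneg (y - x)
  rw [star_trivial, mulVec_sub, sub_dotProduct, dotProduct_sub, dotProduct_sub,
    dotProduct_mulVec_symm hM.isHermitian x y, hxy, hxx] at h
  linarith

lemma eigenvec_dotProduct_eq_zero {M : Matrix n n ℝ} {J : Matrix m n ℝ}
    (hA : (J * M⁻¹ * Jᵀ).IsHermitian) {u : m → ℝ} (hu : Jᵀ *ᵥ u = 0) {j : m}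
    (hj : hA.eigenvalues j ≠ 0) : eigenvec hA j ⬝ᵥ u = 0 := by
  have h : u ⬝ᵥ (J * M⁻¹ * Jᵀ) *ᵥ eigenvec hA j = 0 := by
    rw [dotProduct_mulVec_symm hA, ← mulVec_mulVec, hu]
    simp
  rw [mulVec_eigenvec, dotProduct_smul, smul_eq_mul, dotProduct_comm] at h
  exact (mul_eq_zero.mp h).resolve_left hj

lemma map_inv_quadForm_le {M : Matrix n n ℝ} (hM : M.PosDef) (J : Matrix m n ℝ)
    (hA : (J * M⁻¹ * Jᵀ).IsHermitian) {f : ℝ → ℝ}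
    (hf : ConvexOn ℝ (Ioi 0) fun t => f t⁻¹) (hf' : AntitoneOn (fun t => f t⁻¹) (Ioi 0))
    {y : n → ℝ} (hy : J *ᵥ y ⬝ᵥ J *ᵥ y = 1) :
    f (y ⬝ᵥ M *ᵥ y)⁻¹ ≤ ∑ j, (eigenvec hA j ⬝ᵥ J *ᵥ y) ^ 2 * f (hA.eigenvalues j) := by
  have hev : ∀ j, 0 ≤ hA.eigenvalues j := (posSemidef_conj_inv hM J).eigenvalues_nonneg
  have hker : ∀ j, hA.eigenvalues j = 0 → eigenvec hA j ⬝ᵥ J *ᵥ y = 0 := by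
    intro j hj
    have h : Jᵀ *ᵥ eigenvec hA j = 0 :=
      transpose_mulVec_eq_zero hM (by rw [mulVec_eigenvec, hj, zero_smul])
    rw [dotProduct_mulVec, ← mulVec_transpose, h, zero_dotProduct]
  set t : m → ℝ := fun j => if hA.eigenvalues j = 0 then 1 else (hA.eigenvalues j)⁻¹ with ht
  have htpos : ∀ j, t j ∈ Ioi (0 : ℝ) := by
    intro j
    by_cases h : hA.eigenvalues j = 0
    · simp [ht, h]
    · simpa [ht, h] using lt_of_le_of_ne (hev j) (Ne.symm h)
  have hw : ∑ j, (eigenvec hA j ⬝ᵥ J *ᵥ y) ^ 2 = 1 := by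
    rw [sum_sq_eigenvec_dotProduct, hy]
  have hsum : ∑ j, (eigenvec hA j ⬝ᵥ J *ᵥ y) ^ 2 • t j =
      ∑ j, (eigenvec hA j ⬝ᵥ J *ᵥ y) ^ 2 * (hA.eigenvalues j)⁻¹ := by
    refine Finset.sum_congr rfl fun j _ => ?_
    by_cases h : hA.eigenvalues j = 0
    · simp [hker j h]
    · simp [ht, h]
  have hmem : ∑ j, (eigenvec hA j ⬝ᵥ J *ᵥ y) ^ 2 • t j ∈ Ioi (0 : ℝ) :=
    (convex_Ioi (0 : ℝ)).sum_mem (fun j _ => sq_nonneg _) hw fun j _ => htpos j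
  have hle := sum_sq_div_le hM J hA y
  rw [← hsum] at hle
  refine (hf' hmem (lt_of_lt_of_le hmem hle) hle).trans
    ((hf.map_sum_le (fun j _ => sq_nonneg _) hw fun j _ => htpos j).trans_eq ?_)
  refine Finset.sum_congr rfl fun j _ => ?_
  by_cases h : hA.eigenvalues j = 0
  · simp [hker j h]
  · simp [ht, h]

/-- If `t ↦ f (1 / t)` is convex and decreasing on `(0, ∞)`, then `M ↦ tr f (J M⁻¹ Jᵀ)` is convex
on positive definite matrices. -/
lemma trace_cfc_conj_inv_le {M₁ M₂ : Matrix n n ℝ} (h₁ : M₁.PosDef) (h₂ : M₂.PosDef)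
    (J : Matrix m n ℝ) {f : ℝ → ℝ} (hf : ConvexOn ℝ (Ioi 0) fun t => f t⁻¹)
    (hf' : AntitoneOn (fun t => f t⁻¹) (Ioi 0)) {a b : ℝ} (ha : 0 < a) (hb : 0 < b)
    (hab : a + b = 1) :
    (cfc f (J * (a • M₁ + b • M₂)⁻¹ * Jᵀ)).trace ≤
      a * (cfc f (J * M₁⁻¹ * Jᵀ)).trace + b * (cfc f (J * M₂⁻¹ * Jᵀ)).trace := by
  set M := a • M₁ + b • M₂ with hMdef
  have hM : M.PosDef := (h₁.smul ha).add (h₂.smul hb)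
  have hA := (posSemidef_conj_inv hM J).isHermitian
  have hA₁ := (posSemidef_conj_inv h₁ J).isHermitian
  have hA₂ := (posSemidef_conj_inv h₂ J).isHermitian
  have key : ∀ i, f (hA.eigenvalues i) ≤
      a * (∑ j, (eigenvec hA₁ j ⬝ᵥ eigenvec hA i) ^ 2 * f (hA₁.eigenvalues j)) +
      b * (∑ j, (eigenvec hA₂ j ⬝ᵥ eigenvec hA i) ^ 2 * f (hA₂.eigenvalues j)) := by
    intro i
    have hunit : eigenvec hA i ⬝ᵥ eigenvec hA i = 1 := by simp [eigenvec_dotProduct]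
    rcases eq_or_ne (hA.eigenvalues i) 0 with h0 | h0
    · have hJ : Jᵀ *ᵥ eigenvec hA i = 0 :=
        transpose_mulVec_eq_zero hM (by rw [mulVec_eigenvec, h0, zero_smul])
      -- The eigenvector lies in the common kernel, so each side of `key` is `f 0`; nothing is
      -- needed of `f` at `0`.
      have hz : ∀ {N : Matrix n n ℝ} (hB : (J * N⁻¹ * Jᵀ).IsHermitian),
          ∑ j, (eigenvec hB j ⬝ᵥ eigenvec hA i) ^ 2 * f (hB.eigenvalues j) = f 0 := by
        intro N hB
        have : ∀ j, (eigenvec hB j ⬝ᵥ eigenvec hA i) ^ 2 * f (hB.eigenvalues j) =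
            (eigenvec hB j ⬝ᵥ eigenvec hA i) ^ 2 * f 0 := by
          intro j
          by_cases hj : hB.eigenvalues j = 0
          · rw [hj]
          · simp [eigenvec_dotProduct_eq_zero hB hJ hj]
        rw [Finset.sum_congr rfl fun j _ => this j, ← Finset.sum_mul,
          sum_sq_eigenvec_dotProduct, hunit, one_mul]
      rw [hz hA₁, hz hA₂, h0, ← add_mul, hab, one_mul]
    -- The minimizer of the quadratic form of `M` subject to `J y` being the eigenvector.
    · set y : n → ℝ := (hA.eigenvalues i)⁻¹ • (M⁻¹ *ᵥ (Jᵀ *ᵥ eigenvec hA i)) with hy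
      have hJy : J *ᵥ y = eigenvec hA i := by
        have : J *ᵥ (M⁻¹ *ᵥ (Jᵀ *ᵥ eigenvec hA i)) =
            hA.eigenvalues i • eigenvec hA i := by
          rw [← mulVec_eigenvec]
          simp only [mulVec_mulVec, Matrix.mul_assoc]
        rw [hy, mulVec_smul, this, smul_smul, inv_mul_cancel₀ h0, one_smul]
      have hyM : y ⬝ᵥ M *ᵥ y = (hA.eigenvalues i)⁻¹ := by
        have : M *ᵥ y = (hA.eigenvalues i)⁻¹ • Jᵀ *ᵥ eigenvec hA i := by
          rw [hy, mulVec_smul, mulVec_inv_mulVec hM]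
        rw [this, dotProduct_smul, mulVec_transpose, dotProduct_comm, ← dotProduct_mulVec, hJy,
          hunit, smul_eq_mul, mul_one]
      have hy0 : y ≠ 0 := by
        intro h
        rw [h, mulVec_zero] at hJy
        simp [← hJy] at hunit
      have hsplit : y ⬝ᵥ M *ᵥ y = a • (y ⬝ᵥ M₁ *ᵥ y) + b • (y ⬝ᵥ M₂ *ᵥ y) := by
        rw [hMdef, add_mulVec, dotProduct_add, smul_mulVec, smul_mulVec, dotProduct_smul,
          dotProduct_smul]
      have hp₁ : y ⬝ᵥ M₁ *ᵥ y ∈ Ioi (0 : ℝ) := by simpa using h₁.dotProduct_mulVec_pos hy0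
      have hp₂ : y ⬝ᵥ M₂ *ᵥ y ∈ Ioi (0 : ℝ) := by simpa using h₂.dotProduct_mulVec_pos hy0
      have hconv : f (a • (y ⬝ᵥ M₁ *ᵥ y) + b • (y ⬝ᵥ M₂ *ᵥ y))⁻¹ ≤
          a • f (y ⬝ᵥ M₁ *ᵥ y)⁻¹ + b • f (y ⬝ᵥ M₂ *ᵥ y)⁻¹ := hf.2 hp₁ hp₂ ha.le hb.le hab
      rw [← hsplit, hyM, inv_inv, smul_eq_mul, smul_eq_mul] at hconv
      rw [← hJy] at hunit
      have e₁ := map_inv_quadForm_le h₁ J hA₁ hf hf' hunit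
      have e₂ := map_inv_quadForm_le h₂ J hA₂ hf hf' hunit
      rw [hJy] at e₁ e₂
      refine hconv.trans ?_
      gcongr
  -- The squared overlaps of two orthonormal bases form a doubly stochastic matrix.
  have hsum : ∀ {B : Matrix m m ℝ} (hB : B.IsHermitian),
      ∑ i, ∑ j, (eigenvec hB j ⬝ᵥ eigenvec hA i) ^ 2 * f (hB.eigenvalues j) =
        (cfc f B).trace := by
    intro B hB
    rw [trace_cfc_eq_sum hB, Finset.sum_comm]
    refine Finset.sum_congr rfl fun j _ => ?_
    simp only [dotProduct_comm (eigenvec hB j)]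
    rw [← Finset.sum_mul, sum_sq_eigenvec_dotProduct, eigenvec_dotProduct]
    simp
  rw [trace_cfc_eq_sum hA]
  refine (Finset.sum_le_sum fun i _ => key i).trans_eq ?_
  rw [Finset.sum_add_distrib, ← Finset.mul_sum, ← Finset.mul_sum, hsum, hsum]

/-! ### From sublevel sets to convexity by homogeneity -/

omit [Fintype n] [DecidableEq n] in
lemma convex_posDef : Convex ℝ {M : Matrix n n ℝ | M.PosDef} :=
  convex_iff_forall_pos.mpr fun _ h₁ _ h₂ _ _ ha hb _ => (h₁.smul ha).add (h₂.smul hb)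

omit [Fintype n] [DecidableEq n] in
/-- A nonnegative function on the positive definite matrices that is homogeneous of degree `-1` and
has convex unit sublevel set is convex. -/
lemma convexOn_posDef_of_homogeneous {F : Matrix n n ℝ → ℝ} (h0 : ∀ M, M.PosDef → 0 ≤ F M)
    (hsmul : ∀ c : ℝ, 0 < c → ∀ M, M.PosDef → F (c • M) = c⁻¹ * F M)
    (hlevel : ∀ M₁ M₂ : Matrix n n ℝ, M₁.PosDef → M₂.PosDef → F M₁ ≤ 1 → F M₂ ≤ 1 →
      ∀ a b : ℝ, 0 < a → 0 < b → a + b = 1 → F (a • M₁ + b • M₂) ≤ 1) :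
    ConvexOn ℝ {M : Matrix n n ℝ | M.PosDef} F := by
  refine convexOn_iff_forall_pos.mpr ⟨convex_posDef, fun M₁ h₁ M₂ h₂ a b ha hb hab => ?_⟩
  refine le_of_forall_pos_le_add fun δ hδ => ?_
  -- `F` may vanish; `δ` makes the scale positive, and `s • M₁` lies in the unit sublevel set.
  set s := F M₁ + δ with hs
  set r := F M₂ + δ with hr
  have hspos : 0 < s := add_pos_of_nonneg_of_pos (h0 _ h₁) hδ
  have hrpos : 0 < r := add_pos_of_nonneg_of_pos (h0 _ h₂) hδ
  set t := a / s + b / r with ht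
  have htpos : 0 < t := by positivity
  have h := hlevel (s • M₁) (r • M₂) (h₁.smul hspos) (h₂.smul hrpos)
    (by rw [hsmul s hspos M₁ h₁, inv_mul_le_iff₀ hspos]; linarith)
    (by rw [hsmul r hrpos M₂ h₂, inv_mul_le_iff₀ hrpos]; linarith)
    (t⁻¹ * (a / s)) (t⁻¹ * (b / r)) (by positivity) (by positivity)
    (by rw [← mul_add, ← ht, inv_mul_cancel₀ htpos.ne'])
  have heq : (t⁻¹ * (a / s)) • s • M₁ + (t⁻¹ * (b / r)) • r • M₂ = t⁻¹ • (a • M₁ + b • M₂) := by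
    rw [smul_add, smul_smul, smul_smul, smul_smul, smul_smul]
    congr 2 <;> field_simp
  rw [heq, hsmul _ (inv_pos.mpr htpos) _ ((h₁.smul ha).add (h₂.smul hb)), inv_inv,
    ← le_div_iff₀' htpos, one_div] at h
  -- Harmonic-arithmetic mean inequality: `(a / s + b / r)⁻¹ ≤ a * s + b * r`.
  have hconv := (convexOn_zpow (𝕜 := ℝ) (-1)).2 (inv_pos.mpr hspos) (inv_pos.mpr hrpos)
    ha.le hb.le hab
  simp only [_root_.zpow_neg_one, inv_inv, smul_eq_mul, ← div_eq_mul_inv, ← ht] at hconv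
  simp only [smul_eq_mul]
  calc F (a • M₁ + b • M₂) ≤ a * s + b * r := h.trans hconv
    _ = a * F M₁ + b * F M₂ + (a + b) * δ := by rw [hs, hr]; ring
    _ = _ := by rw [hab, one_mul]

omit [Fintype m] [DecidableEq m] in
lemma smul_conj_inv {M : Matrix n n ℝ} (hM : M.PosDef) (J : Matrix m n ℝ) {c : ℝ} (hc : 0 < c) :
    J * (c • M)⁻¹ * Jᵀ = c⁻¹ • (J * M⁻¹ * Jᵀ) := by
  have : (c • M)⁻¹ = c⁻¹ • M⁻¹ := by
    refine inv_eq_right_inv ?_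
    rw [smul_mul_smul_comm, mul_inv_cancel₀ hc.ne', one_smul,
      mul_nonsing_inv _ ((isUnit_iff_isUnit_det _).mp hM.isUnit)]
  rw [this, Matrix.mul_smul, Matrix.smul_mul]

lemma det_conj_inv_eq_zero {M₁ M₂ : Matrix n n ℝ} (h₁ : M₁.PosDef) {J : Matrix m n ℝ}
    (h : (J * M₁⁻¹ * Jᵀ).det = 0) : (J * M₂⁻¹ * Jᵀ).det = 0 := by
  obtain ⟨v, hv, hv'⟩ := exists_mulVec_eq_zero_iff.mpr h
  refine exists_mulVec_eq_zero_iff.mp ⟨v, hv, ?_⟩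
  rw [← mulVec_mulVec, transpose_mulVec_eq_zero h₁ hv', mulVec_zero]

lemma log_det_eq_trace_cfc {A : Matrix n n ℝ} (hA : A.IsHermitian) (h : A.det ≠ 0) :
    Real.log A.det = (cfc Real.log A).trace := by
  rw [trace_cfc_eq_sum hA, hA.det_eq_prod_eigenvalues]
  rw [hA.det_eq_prod_eigenvalues] at h
  exact Real.log_prod fun i _ => (Finset.prod_ne_zero_iff.mp h) i (Finset.mem_univ i)

end Spectral

/-! ### Kiefer's criterion -/

lemma convexOn_inv_rpow {p : ℝ} (hp : 0 < p) : ConvexOn ℝ (Ioi 0) fun t : ℝ => (t⁻¹) ^ p := by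
  have hlog : ConvexOn ℝ (Ioi 0) fun t : ℝ => p * -Real.log t :=
    strictConcaveOn_log_Ioi.concaveOn.neg.smul hp.le
  have hexp : ConvexOn ℝ (Ioi 0) (Real.exp ∘ fun t : ℝ => p * -Real.log t) := by
    refine ⟨convex_Ioi 0, fun x hx y hy a b ha hb hab => ?_⟩
    exact (Real.exp_le_exp.mpr (hlog.2 hx hy ha hb hab)).trans
      (convexOn_exp.2 (mem_univ _) (mem_univ _) ha hb hab)
  refine hexp.congr fun t ht => ?_
  rw [Function.comp_apply, Real.rpow_def_of_pos (inv_pos.mpr ht), Real.log_inv, mul_comm]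

lemma antitoneOn_inv_rpow {p : ℝ} (hp : 0 < p) :
    AntitoneOn (fun t : ℝ => (t⁻¹) ^ p) (Ioi 0) := fun _ hx _ hy hxy =>
  Real.rpow_le_rpow (inv_nonneg.mpr (le_of_lt hy)) (inv_anti₀ hx hxy) hp.le

lemma convexOn_log_inv : ConvexOn ℝ (Ioi 0) fun t : ℝ => Real.log t⁻¹ := by
  simp only [Real.log_inv]
  exact strictConcaveOn_log_Ioi.concaveOn.neg

lemma antitoneOn_log_inv : AntitoneOn (fun t : ℝ => Real.log t⁻¹) (Ioi 0) := fun _ hx _ hy hxy =>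
  Real.log_le_log (inv_pos.mpr hy) (inv_anti₀ hx hxy)

lemma trace_cfc_rpow_nonneg {q : ℕ} (p : ℝ) {A : Matrix (Fin q) (Fin q) ℝ} (hA : A.PosSemidef) :
    0 ≤ (cfc (fun t : ℝ => t ^ p) A).trace := by
  rw [trace_cfc_eq_sum hA.isHermitian]
  exact Finset.sum_nonneg fun i _ => Real.rpow_nonneg (hA.eigenvalues_nonneg i) _

lemma kieferPhi_nonneg {q : ℕ} (p : ℝ) {A : Matrix (Fin q) (Fin q) ℝ} (hA : A.PosSemidef) :
    0 ≤ kieferPhi p A := by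
  unfold kieferPhi
  split_ifs
  · exact Real.rpow_nonneg hA.det_nonneg _
  · exact Real.rpow_nonneg (mul_nonneg (by positivity) (trace_cfc_rpow_nonneg p hA)) _

lemma kieferPhi_smul {q : ℕ} (hq : 1 ≤ q) (p : ℝ) {A : Matrix (Fin q) (Fin q) ℝ}
    (hA : A.PosSemidef) {c : ℝ} (hc : 0 < c) : kieferPhi p (c • A) = c * kieferPhi p A := by
  have hq0 : (q : ℝ) ≠ 0 := by positivity
  unfold kieferPhi
  split_ifs with hp
  · rw [det_smul, Fintype.card_fin, Real.mul_rpow (by positivity) hA.det_nonneg,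
      ← Real.rpow_natCast, ← Real.rpow_mul hc.le, mul_one_div_cancel hq0, Real.rpow_one]
  · have hcfc : cfc (fun t : ℝ => t ^ p) (c • A) = c ^ p • cfc (fun t : ℝ => t ^ p) A := by
      have hcont : ∀ g : ℝ → ℝ, ContinuousOn g (spectrum ℝ A) := fun g =>
        A.finite_real_spectrum.continuousOn g
      refine (cfc_comp_smul c (fun t : ℝ => t ^ p) A
        -- The spectrum is finite, so continuity is automatic; it is nonnegative, so the power is
        -- multiplicative there.
        ((A.finite_real_spectrum.image _).continuousOn _) hA.isHermitian).symm.trans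
        (Eq.trans (cfc_congr fun t ht => ?_) (cfc_smul (c ^ p) (fun t : ℝ => t ^ p) A (hcont _)))
      rw [hA.isHermitian.spectrum_real_eq_range_eigenvalues] at ht
      obtain ⟨i, rfl⟩ := ht
      exact Real.mul_rpow hc.le (hA.eigenvalues_nonneg i)
    rw [hcfc, trace_smul, smul_eq_mul, mul_left_comm, Real.mul_rpow (by positivity)
      (mul_nonneg (by positivity) (trace_cfc_rpow_nonneg p hA)), ← Real.rpow_mul hc.le,
      mul_one_div_cancel hp, Real.rpow_one]

lemma rpow_le_one_iff_of_nonneg {x r : ℝ} (hx : 0 ≤ x) (hr : 0 < r) : x ^ r ≤ 1 ↔ x ≤ 1 := by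
  simpa only [Real.one_rpow] using Real.rpow_le_rpow_iff hx zero_le_one hr

lemma kieferPhi_le_one_iff {q : ℕ} (hq : 1 ≤ q) {p : ℝ} (hp : 0 < p)
    {A : Matrix (Fin q) (Fin q) ℝ} (hA : A.PosSemidef) :
    kieferPhi p A ≤ 1 ↔ (cfc (fun t : ℝ => t ^ p) A).trace ≤ q := by
  have hq0 : (0 : ℝ) < q := by positivity
  have h0 := mul_nonneg (inv_nonneg.mpr hq0.le) (trace_cfc_rpow_nonneg p hA)
  rw [kieferPhi, if_neg hp.ne', rpow_le_one_iff_of_nonneg h0 (by positivity),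
    inv_mul_le_iff₀ hq0, mul_one]

lemma kieferPhi_zero_le_one_iff {q : ℕ} (hq : 1 ≤ q)
    {A : Matrix (Fin q) (Fin q) ℝ} (hA : A.PosSemidef) :
    kieferPhi 0 A ≤ 1 ↔ A.det ≤ 1 := by
  rw [kieferPhi, if_pos rfl, rpow_le_one_iff_of_nonneg hA.det_nonneg (by positivity)]

lemma kieferPhi_conj_inv_le_one {k q : ℕ} (hq : 1 ≤ q) {p : ℝ} (hp : 0 ≤ p)
    (J : Matrix (Fin q) (Fin k) ℝ) {M₁ M₂ : Matrix (Fin k) (Fin k) ℝ} (h₁ : M₁.PosDef)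
    (h₂ : M₂.PosDef) (e₁ : kieferPhi p (J * M₁⁻¹ * Jᵀ) ≤ 1)
    (e₂ : kieferPhi p (J * M₂⁻¹ * Jᵀ) ≤ 1) {a b : ℝ} (ha : 0 < a) (hb : 0 < b)
    (hab : a + b = 1) : kieferPhi p (J * (a • M₁ + b • M₂)⁻¹ * Jᵀ) ≤ 1 := by
  have hM := (h₁.smul ha).add (h₂.smul hb)
  have hA := posSemidef_conj_inv hM J
  have hA₁ := posSemidef_conj_inv h₁ J
  have hA₂ := posSemidef_conj_inv h₂ J
  rcases hp.eq_or_lt with rfl | hp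
  · rw [kieferPhi_zero_le_one_iff hq (by assumption)] at *
    -- The logarithm is useless at determinant `0`, but singularity depends only on `J`, so then all
    -- three determinants vanish.
    rcases eq_or_ne (J * M₁⁻¹ * Jᵀ).det 0 with hd | hd
    · exact (det_conj_inv_eq_zero h₁ hd).le.trans zero_le_one
    have hd₂ : (J * M₂⁻¹ * Jᵀ).det ≠ 0 := fun h => hd (det_conj_inv_eq_zero h₂ h)
    have hd₀ : (J * (a • M₁ + b • M₂)⁻¹ * Jᵀ).det ≠ 0 := fun h => hd (det_conj_inv_eq_zero hM h)
    have h := trace_cfc_conj_inv_le h₁ h₂ J convexOn_log_inv antitoneOn_log_inv ha hb hab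
    rw [← log_det_eq_trace_cfc hA.isHermitian hd₀, ← log_det_eq_trace_cfc hA₁.isHermitian hd,
      ← log_det_eq_trace_cfc hA₂.isHermitian hd₂] at h
    refine (Real.log_nonpos_iff hA.det_nonneg).mp (h.trans ?_)
    have l₁ := mul_nonneg ha.le (neg_nonneg.mpr (Real.log_nonpos hA₁.det_nonneg e₁))
    have l₂ := mul_nonneg hb.le (neg_nonneg.mpr (Real.log_nonpos hA₂.det_nonneg e₂))
    linarith
  · rw [kieferPhi_le_one_iff hq hp (by assumption)] at *
    refine (trace_cfc_conj_inv_le h₁ h₂ J (convexOn_inv_rpow hp) (antitoneOn_inv_rpow hp)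
      ha hb hab).trans ?_
    calc _ ≤ a * (q : ℝ) + b * q := by gcongr
      _ = q := by rw [← add_mul, hab, one_mul]

lemma convexOn_kieferPhi_conj_inv {k q : ℕ} (hq : 1 ≤ q) {p : ℝ} (hp : 0 ≤ p)
    (J : Matrix (Fin q) (Fin k) ℝ) :
    ConvexOn ℝ {M : Matrix (Fin k) (Fin k) ℝ | M.PosDef}
      fun M => kieferPhi p (J * M⁻¹ * Jᵀ) := by
  refine convexOn_posDef_of_homogeneous
    (fun M hM => kieferPhi_nonneg p (posSemidef_conj_inv hM J)) (fun c hc M hM => ?_)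
    (fun M₁ M₂ h₁ h₂ e₁ e₂ a b ha hb hab =>
      kieferPhi_conj_inv_le_one hq hp J h₁ h₂ e₁ e₂ ha hb hab)
  simp only [smul_conj_inv hM J hc,
    kieferPhi_smul hq p (posSemidef_conj_inv hM J) (inv_pos.mpr hc)]

/-! ### Passage to the weights -/

lemma convex_omegaEps (N : ℕ) (ε : ℝ) : Convex ℝ (OmegaEps N ε) := by
  rintro u ⟨⟨hu0, hu1⟩, hu⟩ v ⟨⟨hv0, hv1⟩, hv⟩ a b ha hb hab
  have hbox : ∀ i, 0 ≤ (a • u + b • v) i ∧ (a • u + b • v) i ≤ ε := fun i =>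
    convex_Icc 0 ε (hu i) (hv i) ha hb hab
  refine ⟨⟨fun i => (hbox i).1, ?_⟩, hbox⟩
  simp [Finset.sum_add_distrib, ← Finset.mul_sum, hu1, hv1, hab]

/-- `w ↦ M(w)` as a linear map. -/
noncomputable def weightedInfoLinear {X Y : Type*} [MeasurableSpace Y] {k N : ℕ} (P : ParametricModel X Y k)
    (x : Fin N → X) (θ : EuclideanSpace ℝ (Fin k)) :
    (Fin N → ℝ) →ₗ[ℝ] Matrix (Fin k) (Fin k) ℝ where
  toFun := weightedInfo P x θ
  map_add' u v := by simp [weightedInfo, add_smul, Finset.sum_add_distrib]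
  map_smul' c u := by simp [weightedInfo, mul_smul, Finset.smul_sum]

end OptimalSample

theorem mainTheorem8 {X Y : Type*} [MeasurableSpace Y] {k q N : ℕ} (hq : 1 ≤ q) (hqk : q ≤ k)
    (P : OptimalSample.ParametricModel X Y k) (x : Fin N → X)
    (θ : EuclideanSpace ℝ (Fin k)) (hθ : θ ∈ P.params)
    (hP : ∀ i, P.HasInfoAt (x i) θ)
    (g : EuclideanSpace ℝ (Fin k) → EuclideanSpace ℝ (Fin q)) (hg : DifferentiableAt ℝ g θ)
    (ε : ℝ) (hε0 : 0 < ε) (hε1 : ε < 1) (p : ℝ) (hp : 0 ≤ p) :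
    ConvexOn ℝ (OptimalSample.OmegaEpsPos P x θ ε)
      (fun w => OptimalSample.kieferPhi p (OptimalSample.sigmaG P x g θ w)) := by
  have h := (OptimalSample.convexOn_kieferPhi_conj_inv hq hp
    (OptimalSample.jacobian g θ)).comp_linearMap (OptimalSample.weightedInfoLinear P x θ)
  exact h.subset (fun w hw => hw.2) ((OptimalSample.convex_omegaEps N ε).inter h.1)
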